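/- For a locally integrable function $w\ge 0$ on $\mathbb R^n$, let $[w]_{A_1(\mathbb R^n)}\in[0,\infty]$ denote the smallest constant $C$ such that \[ \frac1{|B(x,R)|}\int_{B(x,R)} w(y)\,dy\le C\,\operatorname*{ess\,inf}_{y\in B(x,R)} w(y)\qquad\text{for all }x\in\mathbb R^n,\ R>0, \] where $B(x,R)$ is the open Euclidean ball; write $w\in A_1(\mathbb R^n)$ if $[w]_{A_1(\mathbb R^n)}<\infty$. Let $w_0:[0,\infty)\to[0,\infty)$ and, for each $n$, set $w(x)=w_0(|x|)$ for $x\in\mathbb R^n$. Suppose that there are an integer $N>0$ and a constant $C_*>0$ such that, for every $n\ge N$, $w$ is locally integrable on $\mathbb R^n$, $w\in A_1(\mathbb R^n)$ and $[w]_{A_1(\mathbb R^n)}\le C_*$. Then: (1) $w_0$ is essentially constant over dyadic intervals: there is $\beta\ge1$ such that for all $R>0$ \[ \operatorname*{ess\,sup}_{R\le t\le 2R} w_0(t)\le\beta\,\operatorname*{ess\,inf}_{R\le t\le 2R} w_0(t); \] (2) $w_0$ is comparable with a decreasing function: there are a non-increasing function $v:(0,\infty)\to[0,\infty)$ and a constant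 $c>0$ such that $c^{-1}v(t)\le w_0(t)\le c\,v(t)$ for almost every $t>0$. -/

import Mathlib

open MeasureTheory

noncomputable section

/-- The radial function `w(x) = w₀(|x|)` on Euclidean space `ℝⁿ`. -/
def radialWeight (w₀ : ℝ → ℝ) (n : ℕ) : EuclideanSpace ℝ (Fin n) → ℝ :=
  fun x => w₀ ‖x‖

/-- `C` is an admissible `A₁` constant for the weight `w` on `ℝⁿ`: for all `x` and `R > 0`, the
mean of `w` over `B(x, R)` is at most `C` times the essential infimum of `w` over `B(x, R)`.
The two sides are computed in `[0, ∞]`, so that neither is ever a junk value. -/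
def IsA1Bound {n : ℕ} (w : EuclideanSpace ℝ (Fin n) → ℝ) (C : ENNReal) : Prop :=
  ∀ (x : EuclideanSpace ℝ (Fin n)) (R : ℝ), 0 < R →
    (⨍⁻ y in Metric.ball x R, ENNReal.ofReal (w y) ∂volume) ≤
      C * essInf (fun y => ENNReal.ofReal (w y)) (volume.restrict (Metric.ball x R))

/-- The `A₁` constant `[w]_{A₁(ℝⁿ)}`, with value `∞` if no finite constant is admissible. -/
def a1Constant {n : ℕ} (w : EuclideanSpace ℝ (Fin n) → ℝ) : ENNReal :=
  sInf {C : ENNReal | IsA1Bound w C}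

/-- `w ∈ A₁(ℝⁿ)`: a non-negative locally integrable function with finite `A₁` constant. -/
structure MemA1 {n : ℕ} (w : EuclideanSpace ℝ (Fin n) → ℝ) : Prop where
  nonneg : ∀ᵐ x, 0 ≤ w x
  locallyIntegrable : LocallyIntegrable w
  a1Constant_lt_top : a1Constant w < ⊤

/-- `w₀` is essentially constant over dyadic intervals: for some `β ≥ 1` and all `R > 0`,
`ess sup_{[R, 2R]} w₀ ≤ β ess inf_{[R, 2R]} w₀`. -/
def EssConstOnDyadicIntervals (w₀ : ℝ → ℝ) : Prop :=
  ∃ β : ℝ, 1 ≤ β ∧ ∀ R : ℝ, 0 < R →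
    essSup (fun t => ENNReal.ofReal (w₀ t)) (volume.restrict (Set.Icc R (2 * R))) ≤
      ENNReal.ofReal β *
        essInf (fun t => ENNReal.ofReal (w₀ t)) (volume.restrict (Set.Icc R (2 * R)))

/-- `w₀` is comparable with a decreasing (that is, non-increasing) function: some non-negative
`v`, decreasing over `(0, ∞)`, satisfies `c⁻¹ v ≤ w₀ ≤ c v` almost everywhere in `(0, ∞)`.
(The function `v` may be unbounded near `0`, as for `w₀ t = t ^ (-1/2)`.) -/
def ComparableWithDecreasing (w₀ : ℝ → ℝ) : Prop :=
  ∃ v : ℝ → ℝ, AntitoneOn v (Set.Ioi 0) ∧ (∀ t ∈ Set.Ioi (0 : ℝ), 0 ≤ v t) ∧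
    ∃ c : ℝ, 0 < c ∧
      ∀ᵐ t ∂(volume.restrict (Set.Ioi (0 : ℝ))), c⁻¹ * v t ≤ w₀ t ∧ w₀ t ≤ c * v t

end

open Set Filter Topology

/-! Only balls centred at the origin are needed. In polar coordinates (`IsA1Bound.radial_mean_le`)
the `A₁` bound says that the mean of `w₀` over `(0, r)` against `n s^(n-1) / r^n` is at most `C
w₀(t)` for almost every `t < r`. As `n → ∞` this weight concentrates at `r`; at a Lebesgue-type
point the mean keeps a fixed fraction of `w₀(r)`, so `w₀(r) ≤ 4C w₀(t)`
(`le_mul_of_radial_mean_le`). This is where uniformity in `n` enters.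

Almost-monotonicity gives the decreasing comparison function as a supremum over later good points.
For the dyadic bound, it makes `w₀` at least `w₀(t) / (4C)` on `(R/2, R)` when `t ≥ R`, and the mean
inequality on `(0, 2R)` in dimension `N` alone carries this to almost every `s < 2R`. -/

/-- A property of the norm that holds almost everywhere in `ℝⁿ`, `n > 0`, holds at almost every
positive real number. -/
lemma ae_pos_of_ae_norm {n : ℕ} (hn : 0 < n) {P : ℝ → Prop}
    (h : ∀ᵐ x : EuclideanSpace ℝ (Fin n), P ‖x‖) : ∀ᵐ t : ℝ, 0 < t → P t := by
  have : Nonempty (Fin n) := ⟨⟨0, hn⟩⟩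
  classical
  set f : ℝ → ℝ := fun t => if P t then 0 else 1 with hf
  have h0 : (fun x : EuclideanSpace ℝ (Fin n) => f ‖x‖) =ᵐ[volume] 0 := by
    filter_upwards [h] with x hx
    simp [hf, hx]
  have hint : Integrable (fun x : EuclideanSpace ℝ (Fin n) => f ‖x‖) volume :=
    (integrable_zero _ _ _).congr h0.symm
  have hint' := (integrable_fun_norm_addHaar volume).1 hint
  have heq := integral_fun_norm_addHaar (volume : Measure (EuclideanSpace ℝ (Fin n))) f
  rw [integral_congr_ae h0] at heq
  have hball : (volume : Measure (EuclideanSpace ℝ (Fin n))).real (Metric.ball 0 1) ≠ 0 :=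
    (ENNReal.toReal_pos (Metric.measure_ball_pos _ _ one_pos).ne' measure_ball_lt_top.ne).ne'
  have hz : ∫ y in Ioi (0 : ℝ),
      y ^ (Module.finrank ℝ (EuclideanSpace ℝ (Fin n)) - 1) • f y = 0 := by
    simpa [hball, hn.ne'] using heq.symm
  rw [setIntegral_eq_zero_iff_of_nonneg_ae ?_ hint'] at hz
  · rw [EventuallyEq, ae_restrict_iff' measurableSet_Ioi] at hz
    filter_upwards [hz] with t ht hpos
    by_contra hP
    have := ht hpos
    simp [hf, hP, (show t ≠ 0 from hpos.ne')] at this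
  · refine (ae_restrict_iff' measurableSet_Ioi).2 (Eventually.of_forall fun y hy => ?_)
    have : 0 ≤ f y := by simp only [hf]; split_ifs <;> simp
    have hy' : (0 : ℝ) < y := hy
    simp only [Pi.zero_apply, smul_eq_mul]
    positivity

/-! ### The `A₁` condition in polar coordinates -/

lemma IsA1Bound.of_a1Constant_lt {n : ℕ} {w : EuclideanSpace ℝ (Fin n) → ℝ} {C : ENNReal}
    (h : a1Constant w < C) : IsA1Bound w C := by
  obtain ⟨c, hc, hcC⟩ := sInf_lt_iff.1 h
  exact fun x R hR => (hc x R hR).trans (by gcongr)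

/-- The one-dimensional form of the `A₁` inequality for balls centred at the origin. -/
lemma IsA1Bound.radial_mean_le {w₀ : ℝ → ℝ} (hw₀ : ∀ t : ℝ, 0 ≤ t → 0 ≤ w₀ t) {n : ℕ}
    (hn : 0 < n) (hloc : LocallyIntegrable (radialWeight w₀ n)) {C : ℝ} (hC : 0 ≤ C)
    (hA : IsA1Bound (radialWeight w₀ n) (ENNReal.ofReal C)) {R : ℝ} (hR : 0 < R) :
    IntegrableOn (fun s => s ^ (n - 1) * w₀ s) (Ioo 0 R) ∧
      ∀ᵐ t : ℝ, t ∈ Ioo 0 R → n * ∫ s in Ioo 0 R, s ^ (n - 1) * w₀ s ≤ C * R ^ n * w₀ t := by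
  have : Nonempty (Fin n) := ⟨⟨0, hn⟩⟩
  have hwn : ∀ x : EuclideanSpace ℝ (Fin n), 0 ≤ radialWeight w₀ n x := fun x => hw₀ _ (norm_nonneg _)
  have hint : IntegrableOn (fun x : EuclideanSpace ℝ (Fin n) => w₀ ‖x‖) (Metric.ball (0 : EuclideanSpace ℝ (Fin n)) R) :=
    (hloc.integrableOn_isCompact (isCompact_closedBall (0 : EuclideanSpace ℝ (Fin n)) R)).mono_set
      Metric.ball_subset_closedBall
  refine ⟨by simpa using (integrableOn_fun_norm_addHaar volume).1 hint, ?_⟩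
  have hb : (0 : ℝ) < (volume : Measure (EuclideanSpace ℝ (Fin n))).real (Metric.ball 0 1) :=
    ENNReal.toReal_pos (Metric.measure_ball_pos _ _ one_pos).ne' measure_ball_lt_top.ne
  have hvol : (volume : Measure (EuclideanSpace ℝ (Fin n))).real (Metric.ball 0 R)
      = R ^ n * (volume : Measure (EuclideanSpace ℝ (Fin n))).real (Metric.ball 0 1) := by
    rw [Measure.real, Measure.addHaar_ball _ _ hR.le, ENNReal.toReal_mul,
      ENNReal.toReal_ofReal (by positivity)]
    simp [Measure.real]
  have hpolar : ∫ x in Metric.ball (0 : EuclideanSpace ℝ (Fin n)) R, w₀ ‖x‖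
      = n * (volume : Measure (EuclideanSpace ℝ (Fin n))).real (Metric.ball 0 1)
        * ∫ s in Ioo 0 R, s ^ (n - 1) * w₀ s := by
    have h1 := integral_fun_norm_addHaar (volume : Measure (EuclideanSpace ℝ (Fin n))) ((Iio R).indicator w₀)
    have h2 : (fun x : EuclideanSpace ℝ (Fin n) => (Iio R).indicator w₀ ‖x‖)
        = (Metric.ball (0 : EuclideanSpace ℝ (Fin n)) R).indicator (fun x => w₀ ‖x‖) := by
      ext x
      simp [indicator]
    have h3 : (fun y : ℝ => y ^ (n - 1) • (Iio R).indicator w₀ y)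
        = (Iio R).indicator (fun y => y ^ (n - 1) * w₀ y) := by
      ext y
      by_cases hy : y < R <;> simp [hy]
    rw [h2, integral_indicator measurableSet_ball] at h1
    rw [h1]
    simp only [finrank_euclideanSpace, Fintype.card_fin]
    rw [h3, setIntegral_indicator measurableSet_Iio, Ioi_inter_Iio]
    simp [mul_assoc]
  have key : ∀ᵐ x : EuclideanSpace ℝ (Fin n), ‖x‖ ∈ Ioo 0 R →
      n * ∫ s in Ioo 0 R, s ^ (n - 1) * w₀ s ≤ C * R ^ n * w₀ ‖x‖ := by
    have hinf := ae_essInf_le (μ := volume.restrict (Metric.ball (0 : EuclideanSpace ℝ (Fin n)) R))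
      (f := fun y => ENNReal.ofReal (radialWeight w₀ n y))
    rw [ae_restrict_iff' measurableSet_ball] at hinf
    filter_upwards [hinf] with x hx hxR
    have hle := (hA 0 R hR).trans (mul_le_mul_right (hx (by simpa using hxR.2)) _)
    rw [setLAverage_eq, ← ofReal_integral_eq_lintegral_ofReal (f := radialWeight w₀ n) hint
      (Eventually.of_forall hwn), ← ENNReal.ofReal_mul hC,
      ENNReal.div_le_iff (Metric.measure_ball_pos _ _ hR).ne' measure_ball_lt_top.ne,
      ← ofReal_measureReal measure_ball_lt_top.ne,
      ← ENNReal.ofReal_mul (mul_nonneg hC (hwn x)),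
      ENNReal.ofReal_le_ofReal_iff (mul_nonneg (mul_nonneg hC (hwn x)) measureReal_nonneg)] at hle
    simp only [radialWeight] at hle
    rw [hpolar, hvol] at hle
    refine le_of_mul_le_mul_right ?_ hb
    linarith
  filter_upwards [ae_pos_of_ae_norm hn (P := fun t => t ∈ Ioo 0 R →
    n * ∫ s in Ioo 0 R, s ^ (n - 1) * w₀ s ≤ C * R ^ n * w₀ t) key] with t ht htR using ht htR.1 htR

/-! ### Primitives of the radial density -/

/-- A lower bound for the increments of a function to the right of a point bounds its derivative
there from below. -/
lemma HasDerivAt.le_of_mul_sub_le {F : ℝ → ℝ} {d m r b : ℝ} (h : HasDerivAt F d r) (hrb : r < b)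
    (hm : ∀ x ∈ Ioo r b, m * (x - r) ≤ F x - F r) : m ≤ d := by
  refine ge_of_tendsto h.tendsto_slope_zero_right ?_
  filter_upwards [Ioo_mem_nhdsGT (sub_pos.2 hrb)] with t ht
  have := hm (r + t) ⟨by linarith [ht.1], by linarith [ht.2]⟩
  rw [smul_eq_mul, inv_mul_eq_div, le_div_iff₀ ht.1]
  linarith

/-- The density `s ↦ s ^ k w₀(s)` over `(0, ∞)`. -/
noncomputable def radialDensity (w₀ : ℝ → ℝ) (k : ℕ) : ℝ → ℝ :=
  (Ioi 0).indicator fun s => s ^ k * w₀ s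

lemma locallyIntegrable_radialDensity {w₀ : ℝ → ℝ} {k : ℕ}
    (h : ∀ R : ℝ, 0 < R → IntegrableOn (fun s => s ^ k * w₀ s) (Ioo 0 R)) :
    LocallyIntegrable (radialDensity w₀ k) := by
  intro x
  refine ⟨Iio (|x| + 1), Iio_mem_nhds (by linarith [le_abs_self x]), ?_⟩
  rw [radialDensity, IntegrableOn, integrable_indicator_iff measurableSet_Ioi, IntegrableOn,
    Measure.restrict_restrict measurableSet_Ioi, Ioi_inter_Iio]
  exact h _ (by positivity)

lemma intervalIntegrable_radialDensity {w₀ : ℝ → ℝ} {k : ℕ}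
    (h : ∀ R : ℝ, 0 < R → IntegrableOn (fun s => s ^ k * w₀ s) (Ioo 0 R)) (a b : ℝ) :
    IntervalIntegrable (radialDensity w₀ k) volume a b :=
  intervalIntegrable_iff.2 <| ((locallyIntegrable_radialDensity h).integrableOn_isCompact
    isCompact_uIcc).mono_set uIoc_subset_uIcc

lemma le_integral_radialDensity {w₀ : ℝ → ℝ} {k : ℕ}
    (h : ∀ R : ℝ, 0 < R → IntegrableOn (fun s => s ^ k * w₀ s) (Ioo 0 R))
    {a b m : ℝ} (ha : 0 ≤ a) (hab : a ≤ b) (hm0 : 0 ≤ m)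
    (hm : ∀ᵐ t : ℝ, t ∈ Ioo a b → m ≤ w₀ t) :
    a ^ k * m * (b - a) ≤ ∫ s in a..b, radialDensity w₀ k s := by
  have hg : IntervalIntegrable (radialDensity w₀ k) volume a b :=
    intervalIntegrable_radialDensity h a b
  have : ∫ _ in a..b, a ^ k * m = a ^ k * m * (b - a) := by
    rw [intervalIntegral.integral_const, smul_eq_mul, mul_comm]
  rw [← this]
  refine intervalIntegral.integral_mono_ae_restrict hab (by simp) hg ?_
  refine (ae_restrict_iff' measurableSet_Icc).2 ?_
  filter_upwards [hm, Measure.ae_ne volume a, Measure.ae_ne volume b] with t ht hta htb htI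
  have h1 : a < t := lt_of_le_of_ne htI.1 hta.symm
  have h2 : t < b := lt_of_le_of_ne htI.2 htb
  have h3 : (0 : ℝ) < t := ha.trans_lt h1
  simp only [radialDensity, mem_Ioi, h3, indicator_of_mem]
  gcongr
  exact ht ⟨h1, h2⟩

/-- Concentration near the sphere in high dimension: uniform `A₁` inequalities for balls centred
at the origin give an almost everywhere monotonicity up to a constant. -/
lemma le_mul_of_radial_mean_le {w₀ : ℝ → ℝ} (hw₀ : ∀ t : ℝ, 0 ≤ t → 0 ≤ w₀ t) {N : ℕ}
    (hN : 0 < N) {C : ℝ}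
    (hint : ∀ n : ℕ, N ≤ n → ∀ R : ℝ, 0 < R →
      IntegrableOn (fun s => s ^ (n - 1) * w₀ s) (Ioo 0 R)) {r t : ℝ} (hr : 0 < r)
    (hder : HasDerivAt (fun x => ∫ s in 0..x, radialDensity w₀ (N - 1) s)
      (radialDensity w₀ (N - 1) r) r)
    (hmean : ∀ n : ℕ, N ≤ n → n * ∫ s in Ioo 0 r, s ^ (n - 1) * w₀ s ≤ C * r ^ n * w₀ t) :
    w₀ r ≤ 4 * C * w₀ t := by
  set g := radialDensity w₀ (N - 1) with hg
  set F : ℝ → ℝ := fun x => ∫ s in 0..x, g s with hF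
  have hgi : ∀ a b, IntervalIntegrable g volume a b :=
    intervalIntegrable_radialDensity (hint N le_rfl)
  -- The exponent in `F` stays at `N - 1`, so one point of differentiability serves every `n`.
  have hlim : Tendsto (fun n : ℕ => n * (F r - F (r - r / (2 * n)))) atTop
      (𝓝 (r ^ N * w₀ r / 2)) := by
    have hseq : Tendsto (fun n : ℕ => -(r / (2 * n))) atTop (𝓝[<] 0) := by
      refine tendsto_nhdsWithin_iff.2 ⟨?_, ?_⟩
      · have := (tendsto_const_div_atTop_nhds_zero_nat (r / 2)).neg
        simpa [div_div] using this
      · filter_upwards [eventually_gt_atTop 0] with n hn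
        have : (0 : ℝ) < n := by exact_mod_cast hn
        simp only [mem_Iio, Left.neg_neg_iff]
        positivity
    have h1 := (hder.tendsto_slope_zero_left.comp hseq).const_mul (r / 2)
    have h2 : r / 2 * g r = r ^ N * w₀ r / 2 := by
      obtain ⟨k, rfl⟩ := Nat.exists_eq_succ_of_ne_zero hN.ne'
      simp only [hg, radialDensity, mem_Ioi, hr, indicator_of_mem, Nat.succ_eq_add_one,
        Nat.add_sub_cancel]
      ring
    rw [h2] at h1
    refine h1.congr' ?_
    filter_upwards [eventually_gt_atTop 0] with n hn
    have hn' : (0 : ℝ) < n := by exact_mod_cast hn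
    simp only [Function.comp, smul_eq_mul, ← sub_eq_add_neg, hF]
    field_simp
    ring
  have hbd : ∀ n : ℕ, N ≤ n → n * (F r - F (r - r / (2 * n))) ≤ 2 * (C * r ^ N * w₀ t) := by
    intro n hn
    have hn1 : (1 : ℝ) ≤ n := by exact_mod_cast hN.trans_le hn
    set b := r - r / (2 * n) with hb
    have hbr : b = r * (1 - 1 / (2 * n)) := by rw [hb]; ring
    have hhalf : (1 : ℝ) / (2 * n) ≤ 1 / 2 := by
      rw [div_le_div_iff₀ (by positivity) (by positivity)]; linarith
    have hb0 : 0 < b := by rw [hbr]; exact mul_pos hr (by linarith)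
    have hbr' : b ≤ r := by rw [hb]; linarith [show (0 : ℝ) ≤ r / (2 * n) by positivity]
    have hdiff : F r - F b = ∫ s in b..r, g s :=
      intervalIntegral.integral_interval_sub_left (hgi _ _) (hgi _ _)
    have hsub : Ioo b r ⊆ Ioo 0 r := Ioo_subset_Ioo_left hb0.le
    have hlow : b ^ (n - N) * (F r - F b) ≤ ∫ s in Ioo 0 r, s ^ (n - 1) * w₀ s := by
      rw [hdiff, intervalIntegral.integral_of_le hbr', integral_Ioc_eq_integral_Ioo,
        ← integral_const_mul]
      refine le_trans ?_ (setIntegral_mono_set (hint n hn r hr) ?_ hsub.eventuallyLE)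
      · refine setIntegral_mono_on ?_ ((hint n hn r hr).mono_set hsub) measurableSet_Ioo ?_
        · exact (((intervalIntegrable_iff_integrableOn_Ioo_of_le hbr').1 (hgi b r))).const_mul _
        · intro s hs
          have hs0 : 0 < s := hb0.trans hs.1
          have := hw₀ s hs0.le
          have e : n - 1 = (n - N) + (N - 1) := by omega
          simp only [hg, radialDensity, mem_Ioi, hs0, indicator_of_mem]
          rw [e, pow_add, mul_assoc]
          have := hs.1.le
          gcongr
      · refine (ae_restrict_iff' measurableSet_Ioo).2 (Eventually.of_forall fun s hs => ?_)
        exact mul_nonneg (pow_nonneg hs.1.le _) (hw₀ s hs.1.le)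
    have hF0 : 0 ≤ F r - F b := by
      have := le_integral_radialDensity (hint N le_rfl) hb0.le hbr' le_rfl
        (Eventually.of_forall fun s hs => hw₀ s (hb0.trans hs.1).le)
      rw [hdiff]
      simpa using this
    -- Bernoulli: a window of relative width `1 / (2n)` costs at most a factor 2 in the remaining
    -- power.
    have hpow : r ^ (n - N) / 2 ≤ b ^ (n - N) := by
      have hB := one_add_mul_le_pow (a := -(1 / (2 * (n : ℝ)))) (by linarith) (n - N)
      have h1 : ((n - N : ℕ) : ℝ) ≤ n := by exact_mod_cast Nat.sub_le _ _
      have h2 : ((n - N : ℕ) : ℝ) * (1 / (2 * n)) ≤ 1 / 2 := by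
        calc ((n - N : ℕ) : ℝ) * (1 / (2 * n)) ≤ n * (1 / (2 * n)) := by gcongr
          _ = 1 / 2 := by field_simp
      rw [hbr, mul_pow, div_eq_mul_one_div]
      gcongr
      rw [sub_eq_add_neg]
      linarith
    have hfin : r ^ (n - N) * (n * (F r - F b)) ≤ r ^ (n - N) * (2 * (C * r ^ N * w₀ t)) := by
      have h1 : r ^ n = r ^ (n - N) * r ^ N := by rw [← pow_add]; congr 1; omega
      have h2 := hmean n hn
      rw [h1] at h2
      have h3 : r ^ (n - N) / 2 * (F r - F b) ≤ b ^ (n - N) * (F r - F b) := by gcongr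
      have h4 := mul_le_mul_of_nonneg_left (h3.trans hlow) (zero_le_one.trans hn1)
      linarith
    exact le_of_mul_le_mul_left hfin (by positivity)
  have hfinal := le_of_tendsto hlim ((eventually_ge_atTop N).mono hbd)
  refine le_of_mul_le_mul_left ?_ (pow_pos hr N)
  linarith

/-! ### From almost everywhere inequalities to the two conclusions -/

lemma exists_mem_Ioo_of_ae {P : ℝ → Prop} (h : ∀ᵐ t : ℝ, P t) {a b : ℝ} (hab : a < b) :
    ∃ t ∈ Ioo a b, P t := by
  by_contra hcon
  push Not at hcon
  have h0 : volume (Ioo a b) = 0 := measure_mono_null (fun t ht => hcon t ht) (ae_iff.1 h)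
  simp [hab.not_ge] at h0

/-- A function that is decreasing up to a constant on a set of full measure is comparable with a
decreasing function. -/
lemma comparableWithDecreasing_of_ae {w₀ : ℝ → ℝ} (hw₀ : ∀ t : ℝ, 0 ≤ t → 0 ≤ w₀ t)
    {G : ℝ → Prop} (hG : ∀ᵐ t : ℝ, 0 < t → G t) {K : ℝ} (hK : 1 ≤ K)
    (hmono : ∀ r s : ℝ, 0 < r → r < s → G r → G s → w₀ s ≤ K * w₀ r) :
    ComparableWithDecreasing w₀ := by
  have hbdd : ∀ t, 0 < t → BddAbove (w₀ '' {s | t ≤ s ∧ G s}) := by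
    intro t ht
    obtain ⟨r, hr, hGr⟩ := exists_mem_Ioo_of_ae hG ht
    refine ⟨K * w₀ r, ?_⟩
    rintro _ ⟨s, ⟨hs, hGs⟩, rfl⟩
    exact hmono r s hr.1 (hr.2.trans_le hs) (hGr hr.1) hGs
  have hnonneg : ∀ t, 0 < t → ∀ y ∈ w₀ '' {s | t ≤ s ∧ G s}, 0 ≤ y := by
    rintro t ht _ ⟨s, ⟨hs, -⟩, rfl⟩
    exact hw₀ s (ht.le.trans hs)
  refine ⟨fun t => sSup (w₀ '' {s | t ≤ s ∧ G s}), ?_, fun t ht => Real.sSup_nonneg (hnonneg t ht),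
    K, by linarith, ?_⟩
  · intro t ht t' _ htt'
    obtain ⟨r, hr, hGr⟩ := exists_mem_Ioo_of_ae hG (lt_add_one t')
    have ht' : 0 < t' := lt_of_lt_of_le ht htt'
    exact csSup_le_csSup (hbdd t ht) ⟨_, r, ⟨hr.1.le, hGr (ht'.trans hr.1)⟩, rfl⟩
      (image_mono fun s hs => ⟨htt'.trans hs.1, hs.2⟩)
  · refine (ae_restrict_iff' measurableSet_Ioi).2 ?_
    filter_upwards [hG] with t hGt ht
    have hwt := hw₀ t (le_of_lt ht)
    have hle : w₀ t ≤ sSup (w₀ '' {s | t ≤ s ∧ G s}) :=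
      le_csSup (hbdd t ht) ⟨t, ⟨le_rfl, hGt ht⟩, rfl⟩
    constructor
    · rw [inv_mul_le_iff₀ (by linarith)]
      refine csSup_le ⟨_, t, ⟨le_rfl, hGt ht⟩, rfl⟩ ?_
      rintro _ ⟨s, ⟨hs, hGs⟩, rfl⟩
      rcases hs.eq_or_lt with rfl | hlt
      · exact le_mul_of_one_le_left hwt hK
      · exact hmono t s ht hlt (hGt ht) hGs
    · exact hle.trans (le_mul_of_one_le_left (hwt.trans hle) hK)

lemma essConstOnDyadicIntervals_of_ae {w₀ : ℝ → ℝ} {β : ℝ} (hβ : 1 ≤ β)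
    (h : ∀ R : ℝ, 0 < R → ∀ᵐ s : ℝ, s ∈ Ioo 0 (2 * R) →
      ∀ᵐ t : ℝ, t ∈ Icc R (2 * R) → w₀ t ≤ β * w₀ s) :
    EssConstOnDyadicIntervals w₀ := by
  refine ⟨β, hβ, fun R hR => ?_⟩
  have hβ0 : ENNReal.ofReal β ≠ 0 := by simpa using zero_lt_one.trans_le hβ
  rw [mul_comm (ENNReal.ofReal β), ← ENNReal.div_le_iff hβ0 ENNReal.ofReal_ne_top]
  refine le_essInf_of_ae_le _ ((ae_restrict_iff' measurableSet_Icc).2 ?_)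
  filter_upwards [h R hR, Measure.ae_ne volume (2 * R)] with s hs hne hsI
  rw [ENNReal.div_le_iff hβ0 ENNReal.ofReal_ne_top, mul_comm (ENNReal.ofReal _),
    ← ENNReal.ofReal_mul (zero_le_one.trans hβ)]
  refine essSup_le_of_ae_le _ ((ae_restrict_iff' measurableSet_Icc).2 ?_)
  filter_upwards [hs ⟨hR.trans_le hsI.1, lt_of_le_of_ne hsI.2 hne⟩] with t ht htI
  exact ENNReal.ofReal_le_ofReal (ht htI)

theorem proposition3p16 (w₀ : ℝ → ℝ) (hw₀ : ∀ t : ℝ, 0 ≤ t → 0 ≤ w₀ t)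
    (N : ℕ) (hN : 0 < N) (hA : ∀ n : ℕ, N ≤ n → MemA1 (radialWeight w₀ n))
    (Cstar : ℝ) (hCstar : 0 < Cstar)
    (hbound : ∀ n : ℕ, N ≤ n → a1Constant (radialWeight w₀ n) ≤ ENNReal.ofReal Cstar) :
    EssConstOnDyadicIntervals w₀ ∧ ComparableWithDecreasing w₀ := by
  -- Strictly above `Cstar`, so admissible without knowing that the infimum is attained.
  set C := Cstar + 1 with hC
  have hC1 : 1 ≤ C := by linarith
  have hmean := fun (n : ℕ) (hn : N ≤ n) (R : ℝ) (hR : 0 < R) =>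
    IsA1Bound.radial_mean_le hw₀ (hN.trans_le hn) (hA n hn).locallyIntegrable
      (zero_le_one.trans hC1) (IsA1Bound.of_a1Constant_lt ((hbound n hn).trans_lt
        ((ENNReal.ofReal_lt_ofReal_iff (by linarith)).2 (by linarith)))) hR
  have hint := fun n hn R hR => (hmean n hn R hR).1
  set g := radialDensity w₀ (N - 1) with hg
  have hgi : ∀ a b, IntervalIntegrable g volume a b :=
    intervalIntegrable_radialDensity (hint N le_rfl)
  set G : ℝ → Prop := fun r => HasDerivAt (fun x => ∫ s in 0..x, g s) (g r) r ∧
    ∀ᵐ t : ℝ, t ∈ Ioo 0 r → w₀ r ≤ 4 * C * w₀ t with hGdef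
  have hG : ∀ᵐ r : ℝ, 0 < r → G r := by
    filter_upwards [LocallyIntegrable.ae_hasDerivAt_integral
      (locallyIntegrable_radialDensity (hint N le_rfl))] with r hder hr
    refine ⟨hder 0, ?_⟩
    have hall : ∀ᵐ t : ℝ, ∀ n : ℕ, N ≤ n → t ∈ Ioo 0 r →
        n * ∫ s in Ioo 0 r, s ^ (n - 1) * w₀ s ≤ C * r ^ n * w₀ t :=
      ae_all_iff.2 fun n => by
        by_cases hn : N ≤ n
        · filter_upwards [(hmean n hn r hr).2] with t ht _ using ht
        · exact Eventually.of_forall fun t hn' => absurd hn' hn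
    filter_upwards [hall] with t ht htr
    exact le_mul_of_radial_mean_le hw₀ hN hint hr (hder 0) fun n hn => ht n hn htr
  have hlow : ∀ s, 0 < s → G s → ∀ᵐ t : ℝ, t ∈ Ioo 0 s → w₀ s / (4 * C) ≤ w₀ t := by
    intro s hs hGs
    filter_upwards [hGs.2] with t ht hts
    rw [div_le_iff₀' (by linarith)]
    exact ht hts
  -- The exceptional null set in `G s` depends on `s` and may contain `r`; differentiating the
  -- primitive at `r` removes it.
  have hmono : ∀ r s : ℝ, 0 < r → r < s → G r → G s → w₀ s ≤ 4 * C * w₀ r := by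
    intro r s hr hrs hGr hGs
    have hws := hw₀ s (hr.trans hrs).le
    have hd := hGr.1.le_of_mul_sub_le (m := r ^ (N - 1) * (w₀ s / (4 * C))) hrs ?_
    · simp only [hg, radialDensity, mem_Ioi, hr, indicator_of_mem] at hd
      have := le_of_mul_le_mul_left hd (pow_pos hr _)
      rwa [div_le_iff₀' (by linarith)] at this
    · intro x hx
      rw [intervalIntegral.integral_interval_sub_left (hgi _ _) (hgi _ _)]
      refine le_integral_radialDensity (hint N le_rfl) hr.le hx.1.le (by positivity) ?_
      filter_upwards [hlow s (hr.trans hrs) hGs] with t ht htx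
      exact ht ⟨hr.trans htx.1, htx.2.trans hx.2⟩
  refine ⟨?_, comparableWithDecreasing_of_ae hw₀ hG (by linarith) hmono⟩
  -- `4 ^ N` is the ratio of `(2R)^N` to `(R/2)^N`, `4C` comes from almost-monotonicity, `C` from
  -- the mean; the last 2 is slack.
  refine essConstOnDyadicIntervals_of_ae (β := 4 ^ N * (4 * C) * (2 * C)) ?_ fun R hR => ?_
  · have : (1 : ℝ) ≤ 4 ^ N := one_le_pow₀ (by norm_num)
    exact one_le_mul_of_one_le_of_one_le
      (one_le_mul_of_one_le_of_one_le this (by linarith)) (by linarith)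
  filter_upwards [(hmean N le_rfl (2 * R) (by positivity)).2] with s hs hsR
  filter_upwards [hG] with t hGt htI
  have ht0 : 0 < t := hR.trans_le htI.1
  have hwt := hw₀ t ht0.le
  have hI : ∫ τ in (R / 2)..R, g τ ≤ ∫ τ in Ioo 0 (2 * R), τ ^ (N - 1) * w₀ τ := by
    rw [intervalIntegral.integral_of_le (by linarith), integral_Ioc_eq_integral_Ioo]
    have hsub : Ioo (R / 2) R ⊆ Ioo 0 (2 * R) := Ioo_subset_Ioo (by linarith) (by linarith)
    have he : ∫ τ in Ioo (R / 2) R, g τ = ∫ τ in Ioo (R / 2) R, τ ^ (N - 1) * w₀ τ := by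
      refine setIntegral_congr_fun measurableSet_Ioo fun τ hτ => ?_
      have : 0 < τ := by linarith [hτ.1]
      simp [hg, radialDensity, this]
    rw [he]
    refine setIntegral_mono_set (hint N le_rfl _ (by positivity)) ?_ hsub.eventuallyLE
    refine (ae_restrict_iff' measurableSet_Ioo).2 (Eventually.of_forall fun τ hτ => ?_)
    exact mul_nonneg (pow_nonneg hτ.1.le _) (hw₀ τ hτ.1.le)
  have hL := le_integral_radialDensity (hint N le_rfl) (a := R / 2) (b := R)
    (m := w₀ t / (4 * C)) (by linarith) (by linarith) (by positivity) (by
      filter_upwards [hlow t ht0 (hGt ht0)] with τ hτ hτR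
      exact hτ ⟨by linarith [hτR.1], hτR.2.trans_le htI.1⟩)
  have hI0 := hL.trans hI
  have hN1 : (1 : ℝ) ≤ N := by exact_mod_cast hN
  have hchain : (R / 2) ^ (N - 1) * (w₀ t / (4 * C)) * (R - R / 2) ≤ C * (2 * R) ^ N * w₀ s := by
    refine le_trans ?_ (hs hsR)
    refine hI0.trans (le_mul_of_one_le_left (le_trans ?_ hI0) hN1)
    have : 0 ≤ R - R / 2 := by linarith
    positivity
  have hpow : (R / 2) ^ (N - 1) * (R - R / 2) = (R / 2) ^ N := by
    obtain ⟨k, rfl⟩ := Nat.exists_eq_succ_of_ne_zero hN.ne'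
    simp only [Nat.succ_eq_add_one, Nat.add_sub_cancel]
    ring
  have hpow' : (2 * R) ^ N = (R / 2) ^ N * 4 ^ N := by rw [← mul_pow]; ring
  have hfin : w₀ t / (4 * C) ≤ 4 ^ N * C * w₀ s := by
    refine le_of_mul_le_mul_left ?_ (pow_pos (half_pos hR) N)
    rw [← hpow, mul_right_comm] at *
    rw [hpow'] at hchain
    linarith
  rw [div_le_iff₀' (by linarith)] at hfin
  have hws : 0 ≤ 4 ^ N * (4 * C) * C * w₀ s := by
    have := hw₀ s hsR.1.le
    positivity
  linarith
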